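/- Let $d\in\mathbb N$, $H\in(0,1/2)$, $T>0$, $L>0$, $q>2$, and let $\xi\in\mathbb R^{d\times d}$ be a constant matrix. Let $\mathcal P_2(\mathbb R^d)$ be the set of Borel probability measures on $\mathbb R^d$ with finite second moment, with the $2$-Wasserstein distance $$\mathcal W_2(\mu,\nu)=\Big(\inf_{\pi}\int_{\mathbb R^d\times\mathbb R^d}|x-y|^2\,\pi(dx,dy)\Big)^{1/2},$$ the infimum being over all couplings $\pi$ of $\mu$ and $\nu$. Then there is a constant $C=C_{q,T,L,H,\xi}>0$ such that the following holds for every $b:\mathbb R^d\times\mathcal P_2(\mathbb R^d)\to\mathbb R^d$ with $$|b(x,\mu)-b(y,\nu)|\le L\big(|x-y|+\mathcal W_2(\mu,\nu)\big)\quad\text{for all }x,y,\mu,\nu,\qquad |b(0,\delta_0)|\le L,$$ every probability space $(\Omega,\mathcal F,\mathbb P)$ and every $N\ge1$. Let $X^1_0,\dots,X^N_0$ be identically distributed $\mathbb R^d$-valued random variables, and let $B^{H,1},\dots,B^{H,N}$ be $d$-dimensional fractional Brownian motions on $[0,T]$ with Hurst parameter $H$ (each is a centred Gaussian process with continuous paths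 and independent coordinates, each coordinate having covariance $R_H(s,t)=\frac12(s^{2H}+t^{2H}-|t-s|^{2H})$). Let $X^i$ and $X^{i,N}$, $i=1,\dots,N$, be continuous processes which almost surely satisfy, for all $t\in[0,T]$, $$X^i_t=X^i_0+\int_0^t b\big(X^i_s,\mathcal L_{X^i_s}\big)\,ds+\int_0^t\xi\,dB^{H,i}_s,\qquad X^{i,N}_t=X^i_0+\int_0^t b\big(X^{i,N}_s,\mu^{X,N}_s\big)\,ds+\int_0^t\xi\,dB^{H,i}_s,$$ where $\mathcal L_{X^i_s}$ is the law of $X^i_s$ (required to lie in $\mathcal P_2(\mathbb R^d)$ for every $s\in[0,T]$), $\mu^{X,N}_s=\frac1N\sum_{j=1}^N\delta_{X^{j,N}_s}$, the $ds$-integrands are almost surely integrable on $[0,T]$, and $\int_0^t\xi\,dB^{H,i}_s=\xi\,(B^{H,i}_t-B^{H,i}_0)$. Then, for every $i\in\{1,\dots,N\}$, $$\sup_{t\in[0,T]}\mathbf E\big(|X^i_t|^q\big)+\sup_{t\in[0,T]}\mathbf E\big(|X^{i,N}_t|^q\big)\le C\,\big(1+\mathbf E|X^i_0|^q\big)$$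 as an inequality in $[0,\infty]$; in particular $C$ does not depend on $N$. -/

import Mathlib

open MeasureTheory ProbabilityTheory Set
open scoped NNReal ENNReal

namespace FBMParticles

/-- The state space `ℝ^d` with its Euclidean norm. -/
abbrev State (d : ℕ) : Type := EuclideanSpace ℝ (Fin d)

/-- The set of Borel probability measures on `ℝ^d` with finite second moment. -/
structure P2 (d : ℕ) where
  toMeasure : Measure (State d)
  isProbabilityMeasure : IsProbabilityMeasure toMeasure
  moment_lt_top : ∫⁻ x, ‖x‖ₑ ^ 2 ∂toMeasure < ∞

/-- The couplings of two measures. -/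
def couplings {d : ℕ} (μ ν : Measure (State d)) : Set (Measure (State d × State d)) :=
  {π | π.map Prod.fst = μ ∧ π.map Prod.snd = ν}

/-- The 2-Wasserstein distance on `P2 d`; the infimum over couplings is taken in `[0, ∞]`, and is
finite because both marginals have finite second moments. -/
noncomputable def W2 {d : ℕ} (μ ν : P2 d) : ℝ :=
  ((⨅ π ∈ couplings μ.toMeasure ν.toMeasure,
    ∫⁻ z, ‖z.1 - z.2‖ₑ ^ 2 ∂π) ^ (1 / 2 : ℝ)).toReal

/-- The Dirac measure at the origin. -/
noncomputable def diracZero (d : ℕ) : P2 d :=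
  ⟨Measure.dirac 0, inferInstance, by simp⟩

/-- The empirical measure `N⁻¹ ∑ j, δ_{x j}`, as a measure. -/
noncomputable def empiricalMeasure {d N : ℕ} (x : Fin N → State d) : Measure (State d) :=
  (N : ℝ≥0∞)⁻¹ • ∑ j, Measure.dirac (x j)

theorem isProbabilityMeasure_empiricalMeasure {d N : ℕ} [NeZero N] (x : Fin N → State d) :
    IsProbabilityMeasure (empiricalMeasure x) := by
  constructor
  simp [empiricalMeasure, ENNReal.inv_mul_cancel, NeZero.ne N]

theorem lintegral_empiricalMeasure_lt_top {d N : ℕ} [NeZero N] (x : Fin N → State d) :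
    ∫⁻ y, ‖y‖ₑ ^ 2 ∂(empiricalMeasure x) < ∞ := by
  simp only [empiricalMeasure, lintegral_smul_measure, lintegral_finsetSum_measure,
    lintegral_dirac, smul_eq_mul]
  refine ENNReal.mul_lt_top ?_ ?_
  · simp [NeZero.ne N, pos_iff_ne_zero]
  · exact ENNReal.sum_lt_top.2 fun j _ => ENNReal.pow_lt_top enorm_lt_top

/-- The empirical measure `N⁻¹ ∑ j, δ_{x j}` of `N ≥ 1` points, as an element of `P2 d`. -/
noncomputable def empirical {d N : ℕ} [NeZero N] (x : Fin N → State d) : P2 d :=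
  ⟨empiricalMeasure x, isProbabilityMeasure_empiricalMeasure x,
    lintegral_empiricalMeasure_lt_top x⟩

/-- The global Lipschitz condition on the drift `b : ℝ^d × P2 → ℝ^d`, with its bound at
`(0, δ_0)`. -/
structure LipschitzDrift {d : ℕ} (L : ℝ) (b : State d → P2 d → State d) : Prop where
  lipschitz : ∀ x y μ ν, ‖b x μ - b y ν‖ ≤ L * (‖x - y‖ + W2 μ ν)
  bound_zero : ‖b 0 (diracZero d)‖ ≤ L

/-- `B` is, on `[0, T]`, a `d`-dimensional fractional Brownian motion with Hurst parameter `H`: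
a centred Gaussian process with continuous paths, whose coordinates are mutually uncorrelated
(hence independent) and have the covariance `R_H(s, t) = (s^{2H} + t^{2H} - |t - s|^{2H}) / 2`. -/
structure IsFBM {d : ℕ} {Ω : Type*} [MeasurableSpace Ω] (H T : ℝ) (P : Measure Ω)
    (B : ℝ → Ω → State d) : Prop where
  measurable : ∀ t ∈ Icc 0 T, Measurable (B t)
  gaussian : IsGaussianProcess (fun t : Icc (0 : ℝ) T => B t) P
  centred : ∀ t ∈ Icc 0 T, ∀ k, ∫ ω, B t ω k ∂P = 0
  covariance : ∀ s ∈ Icc 0 T, ∀ t ∈ Icc 0 T, ∀ k l,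
    ∫ ω, B s ω k * B t ω l ∂P =
      if k = l then (s ^ (2 * H) + t ^ (2 * H) - |t - s| ^ (2 * H)) / 2 else 0
  continuous : ∀ᵐ ω ∂P, ContinuousOn (fun t => B t ω) (Icc 0 T)

/-- `X` is a continuous process that satisfies, almost surely and for all `t ∈ [0, T]`,
`X_t = X_0 + ∫_0^t b(X_s, m_s) ds + ∫_0^t ξ dB_s`,
where `m` is a (possibly random) flow of measures.
The integrand `ξ` is constant, so that `∫_0^t ξ dB_s = ξ (B_t - B_0)`. -/
structure SolvesEquation {d : ℕ} {Ω : Type*} [MeasurableSpace Ω] (T : ℝ)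
    (b : State d → P2 d → State d) (ξ : Matrix (Fin d) (Fin d) ℝ) (P : Measure Ω)
    (X0 : Ω → State d) (B : ℝ → Ω → State d) (m : ℝ → Ω → P2 d)
    (X : ℝ → Ω → State d) : Prop where
  measurable : ∀ t ∈ Icc 0 T, Measurable (X t)
  continuous : ∀ᵐ ω ∂P, ContinuousOn (fun t => X t ω) (Icc 0 T)
  integrable : ∀ᵐ ω ∂P, IntegrableOn (fun s => b (X s ω) (m s ω)) (Icc 0 T)
  equation : ∀ᵐ ω ∂P, ∀ t ∈ Icc 0 T,
    X t ω = X0 ω + (∫ s in (0 : ℝ)..t, b (X s ω) (m s ω))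
      + Matrix.toEuclideanCLM (𝕜 := ℝ) ξ (B t ω - B 0 ω)

/-- `X` solves the McKean-Vlasov equation
`X_t = X_0 + ∫_0^t b(X_s, Law(X_s)) ds + ∫_0^t ξ dB_s` on `[0, T]`; in particular the law of `X_t`
has a finite second moment for all `t ∈ [0, T]`. -/
def IsMcKeanVlasovSolution {d : ℕ} {Ω : Type*} [MeasurableSpace Ω] (T : ℝ)
    (b : State d → P2 d → State d) (ξ : Matrix (Fin d) (Fin d) ℝ) (P : Measure Ω)
    (X0 : Ω → State d) (B : ℝ → Ω → State d) (X : ℝ → Ω → State d) : Prop :=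
  ∃ law : ℝ → P2 d, (∀ t ∈ Icc 0 T, (law t).toMeasure = P.map (X t)) ∧
    SolvesEquation T b ξ P X0 B (fun t _ => law t) X

/-- `X` solves the interacting particle system
`X^i_t = X^i_0 + ∫_0^t b(X^i_s, N⁻¹ ∑ j, δ_{X^j_s}) ds + ∫_0^t ξ dB^i_s`, `i = 1, …, N`,
on `[0, T]`. -/
def IsParticleSystem {d N : ℕ} [NeZero N] {Ω : Type*} [MeasurableSpace Ω] (T : ℝ)
    (b : State d → P2 d → State d) (ξ : Matrix (Fin d) (Fin d) ℝ) (P : Measure Ω)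
    (X0 : Fin N → Ω → State d) (B : Fin N → ℝ → Ω → State d)
    (X : Fin N → ℝ → Ω → State d) : Prop :=
  ∀ i, SolvesEquation T b ξ P (X0 i) (B i) (fun t ω => empirical fun j => X j t ω) (X i)

end FBMParticles

/-! ### Grönwall inequalities for possibly non-measurable functions. -/

namespace FBMParticles

/-! Comparing with the Dirac coupling shows that `W2 μ δ₀` to the power q is at most the q-th moment
of μ, so the drift has linear growth in terms of q-th moments. Since ξ is constant, the noise enters
each path additively. Hölder in time then gives, pathwise, |X_t|^q ≤ c(1 + |X_0|^q + |noise_t|^q) +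
c ∫_0^t (|X_s|^q + σ_s) ds, where σ_s is the q-th moment of the measure argument
(`SolvesEquation.rpow_enorm_le`). The noise has Gaussian moments bounded uniformly in time
(`exists_lintegral_noise_le`).

In expectation, σ_s is at most the supremum over particles of the q-th moments: it is an average for
the particle system, and the moment itself for McKean-Vlasov. Grönwall for that supremum
(`lintegral_le_of_mean_field_gronwall`) gives a constant free of N; neither independence nor
exchangeability of the particles is needed.

Grönwall needs the moments to be finite beforehand. For particles, a pathwise Grönwall argument for
the sum over particles gives this, with a bound that may depend on N. For McKean-Vlasov only second
moments of the law are given, so X is compared with one fixed path of itself, which removes the law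
from the drift difference. -/

theorem mul_lintegral_exp_le (K : ℝ≥0) {t : ℝ} (ht : 0 ≤ t) :
    (K : ℝ≥0∞) * ∫⁻ s in Icc 0 t, ENNReal.ofReal (Real.exp (2 * K * s)) ≤
      ENNReal.ofReal (Real.exp (2 * K * t)) * 2⁻¹ := by
  have hder : ∀ s ∈ uIcc 0 t, HasDerivAt (fun s : ℝ => Real.exp (2 * K * s) / 2)
      (K * Real.exp (2 * K * s)) s := by
    intro s _
    have h1 : HasDerivAt (fun s : ℝ => 2 * (K : ℝ) * s) (2 * K) s := by
      simpa using (hasDerivAt_id s).const_mul (2 * (K : ℝ))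
    exact (h1.exp.div_const 2).congr_deriv (by ring)
  have hcont : Continuous fun s : ℝ => (K : ℝ) * Real.exp (2 * K * s) := by fun_prop
  have hint := intervalIntegral.integral_eq_sub_of_hasDerivAt hder (hcont.intervalIntegrable 0 t)
  rw [← lintegral_const_mul _ (by fun_prop)]
  have hcongr : ∀ s : ℝ, (K : ℝ≥0∞) * ENNReal.ofReal (Real.exp (2 * K * s)) =
      ENNReal.ofReal (K * Real.exp (2 * K * s)) := by
    intro s
    rw [ENNReal.ofReal_mul K.coe_nonneg, ENNReal.ofReal_coe_nnreal]
  simp_rw [hcongr]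
  rw [← ofReal_integral_eq_lintegral_ofReal
    (hcont.continuousOn.integrableOn_compact isCompact_Icc)
    (ae_of_all _ fun s => by positivity), integral_Icc_eq_integral_Ioc,
    ← intervalIntegral.integral_of_le ht, hint]
  have h2 : (2⁻¹ : ℝ≥0∞) = ENNReal.ofReal (2⁻¹) := by
    rw [ENNReal.ofReal_inv_of_pos (by norm_num)]; simp
  rw [h2, ← ENNReal.ofReal_mul (Real.exp_pos _).le]
  apply ENNReal.ofReal_le_ofReal
  simp
  linarith

/-- A Grönwall inequality for bounded functions, without any measurability assumption. -/
theorem gronwall_of_bounded {T : ℝ} {h : ℝ → ℝ≥0∞} {a M : ℝ≥0∞} {K : ℝ≥0} (hM : M ≠ ∞)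
    (hb : ∀ t ∈ Icc 0 T, h t ≤ M)
    (hh : ∀ t ∈ Icc 0 T, h t ≤ a + K * ∫⁻ s in Icc 0 t, h s) :
    ∀ t ∈ Icc 0 T, h t ≤ 2 * a * ENNReal.ofReal (Real.exp (2 * K * T)) := by
  -- Supremum weighted by exp(-2Ks): the rate 2K, twice the Grönwall rate, makes the integral term
  -- contribute at most S/2. Only upper bounds of h by exponentials are integrated, so h need not be
  -- measurable.
  set S : ℝ≥0∞ := ⨆ s ∈ Icc 0 T, h s * ENNReal.ofReal (Real.exp (-(2 * K * s))) with hS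
  have hmul : ∀ s : ℝ, ENNReal.ofReal (Real.exp (-(2 * K * s))) *
      ENNReal.ofReal (Real.exp (2 * K * s)) = 1 := by
    intro s
    rw [← ENNReal.ofReal_mul (Real.exp_pos _).le, ← Real.exp_add]
    simp
  have hS_top : S ≠ ∞ := by
    refine ne_top_of_le_ne_top hM (iSup₂_le fun s hs => ?_)
    calc h s * ENNReal.ofReal (Real.exp (-(2 * K * s))) ≤ M * 1 := by
          gcongr
          · exact hb s hs
          · rw [← ENNReal.ofReal_one]
            refine ENNReal.ofReal_le_ofReal (Real.exp_le_one_iff.2 ?_)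
            have := hs.1
            have := K.2
            simp only [Left.neg_nonpos_iff]
            positivity
      _ = M := mul_one M
  have hle : ∀ s ∈ Icc 0 T, h s ≤ S * ENNReal.ofReal (Real.exp (2 * K * s)) := by
    intro s hs
    calc h s = h s * ENNReal.ofReal (Real.exp (-(2 * K * s))) *
          ENNReal.ofReal (Real.exp (2 * K * s)) := by rw [mul_assoc, hmul, mul_one]
      _ ≤ _ := by
        gcongr
        exact le_iSup₂_of_le s hs le_rfl
  have hstep : S ≤ a + S * 2⁻¹ := by
    refine iSup₂_le fun t ht => ?_
    have hint : (K : ℝ≥0∞) * ∫⁻ s in Icc 0 t, h s ≤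
        S * 2⁻¹ * ENNReal.ofReal (Real.exp (2 * K * t)) := by
      calc (K : ℝ≥0∞) * ∫⁻ s in Icc 0 t, h s
          ≤ K * ∫⁻ s in Icc 0 t, S * ENNReal.ofReal (Real.exp (2 * K * s)) := by
            gcongr K * ?_
            exact setLIntegral_mono' measurableSet_Icc
              fun s hs => hle s ⟨hs.1, hs.2.trans ht.2⟩
        _ = S * (K * ∫⁻ s in Icc 0 t, ENNReal.ofReal (Real.exp (2 * K * s))) := by
            rw [lintegral_const_mul _ (by fun_prop)]; ring
        _ ≤ S * (ENNReal.ofReal (Real.exp (2 * K * t)) * 2⁻¹) := by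
            gcongr S * ?_
            exact mul_lintegral_exp_le K ht.1
        _ = _ := by ring
    calc h t * ENNReal.ofReal (Real.exp (-(2 * K * t)))
        ≤ (a + S * 2⁻¹ * ENNReal.ofReal (Real.exp (2 * K * t))) *
          ENNReal.ofReal (Real.exp (-(2 * K * t))) := by
          gcongr
          exact (hh t ht).trans (by gcongr)
      _ = a * ENNReal.ofReal (Real.exp (-(2 * K * t))) + S * 2⁻¹ := by
          rw [add_mul, mul_assoc (S * 2⁻¹), mul_comm (ENNReal.ofReal (Real.exp (2 * K * t))),
            hmul, mul_one]
      _ ≤ a * 1 + S * 2⁻¹ := by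
          gcongr
          rw [← ENNReal.ofReal_one]
          refine ENNReal.ofReal_le_ofReal (Real.exp_le_one_iff.2 ?_)
          have := ht.1
          have := K.2
          simp only [Left.neg_nonpos_iff]
          positivity
      _ = a + S * 2⁻¹ := by rw [mul_one]
  have hhalf : S * 2⁻¹ + S * 2⁻¹ = S := by
    rw [← mul_add, ENNReal.inv_two_add_inv_two, mul_one]
  have hSa : S * 2⁻¹ ≤ a := by
    -- Absorbing S/2 into the left side is legitimate only for finite S; this is where boundedness
    -- of h enters.
    have hfin : S * 2⁻¹ ≠ ∞ := ENNReal.mul_ne_top hS_top (by simp)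
    refine (ENNReal.add_le_add_iff_right hfin).1 ?_
    rw [hhalf]
    exact hstep
  have hS2 : S ≤ 2 * a := by
    rw [← hhalf, two_mul]
    exact add_le_add hSa hSa
  intro t ht
  refine (hle t ht).trans ?_
  gcongr
  exact ht.2

/-- Grönwall's inequality with a forcing term that depends on time. -/
theorem gronwall_of_bounded_forcing {T : ℝ} {y α : ℝ → ℝ≥0∞} {M : ℝ≥0∞} {K : ℝ≥0}
    (hα : Measurable α) (hM : M ≠ ∞) (hb : ∀ t ∈ Icc 0 T, y t ≤ M)
    (hy : ∀ t ∈ Icc 0 T, y t ≤ α t + K * ∫⁻ s in Icc 0 t, y s) :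
    ∀ t ∈ Icc 0 T, y t ≤ α t +
      K * (2 * ENNReal.ofReal (Real.exp (2 * K * T))) * ∫⁻ s in Icc 0 T, α s := by
  intro t ht
  -- Grönwall is applied to the primitive of y, whose forcing is at most the full integral of α. The
  -- resulting bound is linear in α, so it survives taking expectations.
  have hz := gronwall_of_bounded (T := T) (h := fun t => ∫⁻ s in Icc 0 t, y s)
    (a := ∫⁻ s in Icc 0 T, α s) (M := M * ENNReal.ofReal T) (K := K)
    (ENNReal.mul_ne_top hM (by simp)) ?_ ?_ t ht
  · refine (hy t ht).trans ?_
    calc α t + K * ∫⁻ s in Icc 0 t, y s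
        ≤ α t + K * (2 * (∫⁻ s in Icc 0 T, α s) * ENNReal.ofReal (Real.exp (2 * K * T))) := by
          gcongr
      _ = _ := by ring
  · intro u hu
    calc ∫⁻ s in Icc 0 u, y s ≤ ∫⁻ s in Icc 0 u, M :=
          setLIntegral_mono' measurableSet_Icc fun s hs => hb s ⟨hs.1, hs.2.trans hu.2⟩
      _ = M * ENNReal.ofReal u := by simp
      _ ≤ _ := mul_le_mul_right (ENNReal.ofReal_le_ofReal hu.2) M
  · intro u hu
    calc ∫⁻ s in Icc 0 u, y s ≤ ∫⁻ s in Icc 0 u, (α s + K * ∫⁻ r in Icc 0 s, y r) :=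
          setLIntegral_mono' measurableSet_Icc fun s hs => hy s ⟨hs.1, hs.2.trans hu.2⟩
      _ = (∫⁻ s in Icc 0 u, α s) + K * ∫⁻ s in Icc 0 u, ∫⁻ r in Icc 0 s, y r := by
          rw [lintegral_add_left hα, lintegral_const_mul' _ _ (by simp)]
      _ ≤ _ := by
          gcongr
          exact hu.2

/-! ### Joint measurability and Grönwall in expectation. -/

section

variable {Ω : Type*} [MeasurableSpace Ω]

/-- A process with almost surely continuous paths on `[0, T]` is indistinguishable there from a
jointly measurable process. -/
theorem exists_measurable_uncurry {E : Type*} [NormedAddCommGroup E] [MeasurableSpace E]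
    [BorelSpace E] {T : ℝ} (hT : 0 ≤ T) {P : Measure Ω} {X : ℝ → Ω → E}
    (hX : ∀ t ∈ Icc 0 T, Measurable (X t))
    (hc : ∀ᵐ ω ∂P, ContinuousOn (fun t => X t ω) (Icc 0 T)) :
    ∃ Y : ℝ → Ω → E, Measurable (Function.uncurry Y) ∧
      ∀ᵐ ω ∂P, ∀ t ∈ Icc 0 T, Y t ω = X t ω := by
  classical
  -- The discontinuity set need not be measurable, so a measurable null set containing it is
  -- discarded.
  set G : Set Ω := (toMeasurable P {ω | ¬ ContinuousOn (fun t => X t ω) (Icc 0 T)})ᶜ with hG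
  have hGm : MeasurableSet G := (measurableSet_toMeasurable _ _).compl
  have hGc : ∀ ω ∈ G, ContinuousOn (fun t => X t ω) (Icc 0 T) := by
    intro ω hω
    by_contra hn
    exact hω (subset_toMeasurable _ _ hn)
  let Z : Icc (0 : ℝ) T → Ω → E := fun t => G.indicator (X t)
  have hZ : Measurable (Function.uncurry Z) := by
    refine measurable_uncurry_of_continuous_of_measurable (fun ω => ?_)
      fun t => (hX t t.2).indicator hGm
    by_cases hω : ω ∈ G
    · simp only [Z, indicator_of_mem hω]
      exact continuousOn_iff_continuous_domRestrict.1 (hGc ω hω)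
    · simpa [Z, indicator_of_notMem hω] using continuous_const
  refine ⟨fun t => Z (projIcc 0 T hT t), ?_, ?_⟩
  · exact hZ.comp (((continuous_projIcc (h := hT)).measurable.comp measurable_fst).prodMk measurable_snd)
  · have : ∀ᵐ ω ∂P, ω ∈ G := by
      have : P Gᶜ = 0 := by
        rw [hG, compl_compl, measure_toMeasurable]
        exact hc
      exact this
    filter_upwards [this] with ω hω t ht
    simp [Z, indicator_of_mem hω, projIcc_of_mem hT ht]

/-- If `y` satisfies a pathwise Grönwall inequality and has bounded paths, then its expectation is
bounded on `[0, T]`. -/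
theorem exists_lintegral_le_of_pathwise_gronwall {P : Measure Ω} [SFinite P] {T : ℝ}
    {y α : ℝ → Ω → ℝ≥0∞} {a : ℝ≥0∞} {K : ℝ≥0}
    (hα : Measurable (Function.uncurry α)) (ha : a ≠ ∞)
    (hαa : ∀ t ∈ Icc 0 T, ∫⁻ ω, α t ω ∂P ≤ a)
    (hb : ∀ᵐ ω ∂P, ∃ M : ℝ≥0∞, M ≠ ∞ ∧ ∀ t ∈ Icc 0 T, y t ω ≤ M)
    (hy : ∀ᵐ ω ∂P, ∀ t ∈ Icc 0 T, y t ω ≤ α t ω + K * ∫⁻ s in Icc 0 t, y s ω) :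
    ∃ M : ℝ≥0∞, M ≠ ∞ ∧ ∀ t ∈ Icc 0 T, ∫⁻ ω, y t ω ∂P ≤ M := by
  set c : ℝ≥0∞ := K * (2 * ENNReal.ofReal (Real.exp (2 * K * T))) with hc
  have hcT : c ≠ ∞ := by finiteness
  refine ⟨a + c * (a * ENNReal.ofReal T), by finiteness, fun t ht => ?_⟩
  calc ∫⁻ ω, y t ω ∂P ≤ ∫⁻ ω, (α t ω + c * ∫⁻ s in Icc 0 T, α s ω) ∂P := by
        refine lintegral_mono_ae ?_
        filter_upwards [hb, hy] with ω ⟨M, hM, hbω⟩ hyω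
        -- The path bound M depends on ω, but it does not enter the conclusion.
        exact gronwall_of_bounded_forcing hα.of_uncurry_right hM hbω hyω t ht
    _ = (∫⁻ ω, α t ω ∂P) + c * ∫⁻ s in Icc 0 T, ∫⁻ ω, α s ω ∂P := by
        rw [lintegral_add_left hα.of_uncurry_left, lintegral_const_mul' _ _ hcT,
          lintegral_lintegral_swap]
        exact (hα.comp measurable_swap).aemeasurable
    _ ≤ a + c * ∫⁻ s in Icc 0 T, a := by
        refine add_le_add (hαa t ht) ?_
        gcongr c * ?_
        exact setLIntegral_mono' measurableSet_Icc hαa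
    _ = _ := by simp

/-- Uniform moment bound for a family of processes with a mean-field interaction term `σ`. -/
theorem lintegral_le_of_mean_field_gronwall {ι : Type*} {P : Measure Ω} [SFinite P]
    {T : ℝ} {y α : ι → ℝ → Ω → ℝ≥0∞} {σ : ℝ → Ω → ℝ≥0∞} {a M : ℝ≥0∞} {K : ℝ≥0}
    (hym : ∀ i, Measurable (Function.uncurry (y i)))
    (hσm : Measurable (Function.uncurry σ))
    (hαm : ∀ i, Measurable (Function.uncurry (α i)))
    (hσ : ∀ t ∈ Icc 0 T, ∫⁻ ω, σ t ω ∂P ≤ ⨆ j, ∫⁻ ω, y j t ω ∂P)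
    (hαa : ∀ i, ∀ t ∈ Icc 0 T, ∫⁻ ω, α i t ω ∂P ≤ a)
    (hM : M ≠ ∞) (hb : ∀ i, ∀ t ∈ Icc 0 T, ∫⁻ ω, y i t ω ∂P ≤ M)
    (hy : ∀ i, ∀ᵐ ω ∂P, ∀ t ∈ Icc 0 T,
      y i t ω ≤ α i t ω + K * ∫⁻ s in Icc 0 t, (y i s ω + σ s ω)) :
    ∀ i, ∀ t ∈ Icc 0 T,
      ∫⁻ ω, y i t ω ∂P ≤ 2 * a * ENNReal.ofReal (Real.exp (4 * K * T)) := by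
  intro i t ht
  set h : ℝ → ℝ≥0∞ := fun t => ⨆ j, ∫⁻ ω, y j t ω ∂P with hh
  -- The process and the interaction each contribute at most h, hence the rate 2K and the final
  -- exponent 4KT.
  have key := gronwall_of_bounded (T := T) (h := h) (a := a) (M := M) (K := 2 * K) hM
    (fun t ht => iSup_le fun j => hb j t ht) ?_ t ht
  · refine (le_iSup (fun j => ∫⁻ ω, y j t ω ∂P) i).trans (key.trans_eq ?_)
    congr 3
    push_cast
    ring
  · intro t ht
    refine iSup_le fun j => ?_
    have hsum : Measurable (Function.uncurry fun s ω => y j s ω + σ s ω) := (hym j).add hσm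
    calc ∫⁻ ω, y j t ω ∂P
        ≤ ∫⁻ ω, (α j t ω + K * ∫⁻ s in Icc 0 t, (y j s ω + σ s ω)) ∂P := by
          refine lintegral_mono_ae ?_
          filter_upwards [hy j] with ω hω using hω t ht
      _ = (∫⁻ ω, α j t ω ∂P) + K * ∫⁻ s in Icc 0 t, ∫⁻ ω, (y j s ω + σ s ω) ∂P := by
          rw [lintegral_add_left (hαm j).of_uncurry_left, lintegral_const_mul' _ _ (by simp),
            lintegral_lintegral_swap]
          exact (hsum.comp measurable_swap).aemeasurable
      _ ≤ a + K * ∫⁻ s in Icc 0 t, 2 * h s := by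
          gcongr (?_ + K * ?_)
          · exact hαa j t ht
          · refine setLIntegral_mono' measurableSet_Icc fun s hs => ?_
            rw [lintegral_add_left (hym j).of_uncurry_left, two_mul]
            exact add_le_add (le_iSup (fun j => ∫⁻ ω, y j s ω ∂P) j)
              (hσ s ⟨hs.1, hs.2.trans ht.2⟩)
      _ = a + (2 * K : ℝ≥0) * ∫⁻ s in Icc 0 t, h s := by
          rw [lintegral_const_mul' _ _ (by simp)]
          push_cast
          ring

end

/-! ### Power inequalities and the pathwise growth estimate. -/

theorem rpow_lintegral_le {X : Type*} [MeasurableSpace X] {μ : Measure X} {f : X → ℝ≥0∞}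
    (hf : AEMeasurable f μ) {q : ℝ} (hq : 1 ≤ q) :
    (∫⁻ x, f x ∂μ) ^ q ≤ μ univ ^ (q - 1) * ∫⁻ x, f x ^ q ∂μ := by
  have hq0 : 0 < q := by linarith
  have h := eLpNorm'_le_eLpNorm'_mul_rpow_measure_univ (p := 1) one_pos hq
    hf.aestronglyMeasurable
  have h1 : eLpNorm' f 1 μ = ∫⁻ x, f x ∂μ := by simp [eLpNorm']
  have h2 : ∫⁻ x, f x ^ q ∂μ = eLpNorm' f q μ ^ q := by
    simpa using lintegral_rpow_enorm_eq_rpow_eLpNorm' (μ := μ) (f := f) hq0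
  rw [h1] at h
  calc (∫⁻ x, f x ∂μ) ^ q ≤ (eLpNorm' f q μ * μ univ ^ (1 / 1 - 1 / q)) ^ q := by gcongr
    _ = _ := by
      rw [ENNReal.mul_rpow_of_nonneg _ _ hq0.le, ← h2, ← ENNReal.rpow_mul, mul_comm]
      congr 2
      field_simp

theorem rpow_add_add_le (a b c : ℝ≥0∞) {q : ℝ} (hq : 1 ≤ q) :
    (a + b + c) ^ q ≤ 3 ^ (q - 1) * (a ^ q + b ^ q + c ^ q) := by
  simpa [Fin.sum_univ_three] using
    ENNReal.rpow_sum_le_const_mul_sum_rpow Finset.univ ![a, b, c] hq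

/-- The constant in the pathwise growth estimate for an equation with Lipschitz drift. -/
noncomputable def pathConst (T L q : ℝ) : ℝ≥0 :=
  ((3 : ℝ≥0∞) ^ (q - 1) * (1 + ENNReal.ofReal T ^ (q - 1) *
    (3 ^ (q - 1) * ENNReal.ofReal L ^ q) * (1 + ENNReal.ofReal T))).toNNReal

theorem coe_pathConst {T L q : ℝ} (hq : 1 ≤ q) :
    (pathConst T L q : ℝ≥0∞) = 3 ^ (q - 1) * (1 + ENNReal.ofReal T ^ (q - 1) *
      (3 ^ (q - 1) * ENNReal.ofReal L ^ q) * (1 + ENNReal.ofReal T)) := by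
  have h1 : 0 ≤ q - 1 := by linarith
  have h2 : 0 ≤ q := by linarith
  exact ENNReal.coe_toNNReal (by finiteness)

/-- Convexity splits the q-th power of the three summands, and Hölder in time moves the power inside
the drift integral at the cost of T^(q-1). Stated for a general path, it also applies to differences
of two solutions. -/
theorem rpow_enorm_path_le {E : Type*} [NormedAddCommGroup E] [NormedSpace ℝ E]
    {T L q : ℝ} (hq : 1 ≤ q) {x β n : ℝ → E} {x₀ : E} {σ : ℝ → ℝ≥0∞}
    (hβ : IntegrableOn β (Icc 0 T))
    (hx : ∀ t ∈ Icc 0 T, x t = x₀ + (∫ s in (0 : ℝ)..t, β s) + n t)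
    (hβx : ∀ s ∈ Icc 0 T, ‖β s‖ₑ ^ q ≤
      3 ^ (q - 1) * ENNReal.ofReal L ^ q * (1 + ‖x s‖ₑ ^ q + σ s)) :
    ∀ t ∈ Icc 0 T, ‖x t‖ₑ ^ q ≤ pathConst T L q * (1 + ‖x₀‖ₑ ^ q + ‖n t‖ₑ ^ q) +
      pathConst T L q * ∫⁻ s in Icc 0 t, (‖x s‖ₑ ^ q + σ s) := by
  intro t ht
  have h1 : 0 ≤ q - 1 := by linarith
  have h2 : 0 ≤ q := by linarith
  set τ := ENNReal.ofReal T ^ (q - 1) with hτ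
  set ℓ := (3 : ℝ≥0∞) ^ (q - 1) * ENNReal.ofReal L ^ q with hℓ
  set J := ∫⁻ s in Icc 0 t, (‖x s‖ₑ ^ q + σ s) with hJ
  have hℓ_top : ℓ ≠ ∞ := by finiteness
  have hint : ‖∫ s in (0 : ℝ)..t, β s‖ₑ ^ q ≤ τ * (ℓ * (ENNReal.ofReal T + J)) := by
    rw [intervalIntegral.integral_of_le ht.1, ← integral_Icc_eq_integral_Ioc]
    calc ‖∫ s in Icc 0 t, β s‖ₑ ^ q ≤ (∫⁻ s in Icc 0 t, ‖β s‖ₑ) ^ q := by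
          gcongr
          exact enorm_integral_le_lintegral_enorm _
      _ ≤ (volume.restrict (Icc 0 t)) univ ^ (q - 1) * ∫⁻ s in Icc 0 t, ‖β s‖ₑ ^ q :=
          rpow_lintegral_le
            (hβ.mono_set (Icc_subset_Icc_right ht.2)).aestronglyMeasurable.enorm hq
      _ ≤ τ * ∫⁻ s in Icc 0 t, ℓ * (1 + (‖x s‖ₑ ^ q + σ s)) := by
          refine mul_le_mul' ?_ (setLIntegral_mono' measurableSet_Icc fun s hs => ?_)
          · refine ENNReal.rpow_le_rpow ?_ h1
            simpa using ENNReal.ofReal_le_ofReal ht.2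
          · rw [← add_assoc]
            exact hβx s ⟨hs.1, hs.2.trans ht.2⟩
      _ = τ * (ℓ * (ENNReal.ofReal t + J)) := by
          rw [lintegral_const_mul' _ _ hℓ_top, lintegral_add_left measurable_const]
          simp [hJ]
      _ ≤ _ := by
          gcongr
          exact ht.2
  rw [hx t ht]
  calc ‖x₀ + (∫ s in (0 : ℝ)..t, β s) + n t‖ₑ ^ q
      ≤ (‖x₀‖ₑ + ‖∫ s in (0 : ℝ)..t, β s‖ₑ + ‖n t‖ₑ) ^ q := by
        gcongr
        exact (enorm_add_le _ _).trans (by gcongr; exact enorm_add_le _ _)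
    _ ≤ 3 ^ (q - 1) * (‖x₀‖ₑ ^ q + ‖∫ s in (0 : ℝ)..t, β s‖ₑ ^ q + ‖n t‖ₑ ^ q) :=
        rpow_add_add_le _ _ _ hq
    _ ≤ 3 ^ (q - 1) * (‖x₀‖ₑ ^ q + τ * (ℓ * (ENNReal.ofReal T + J)) + ‖n t‖ₑ ^ q) := by
        gcongr
    -- The added terms are exactly what is missing from the expanded product with `pathConst`, so
    -- the rest is an identity.
    _ ≤ 3 ^ (q - 1) * (‖x₀‖ₑ ^ q + τ * (ℓ * (ENNReal.ofReal T + J)) + ‖n t‖ₑ ^ q) +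
        3 ^ (q - 1) * (1 + τ * ℓ + τ * ℓ * (1 + ENNReal.ofReal T) * (‖x₀‖ₑ ^ q + ‖n t‖ₑ ^ q) +
          J + τ * ℓ * ENNReal.ofReal T * J) := le_self_add
    _ = _ := by
        rw [coe_pathConst hq]
        ring

/-! ### Wasserstein distance and growth of the drift. -/

/-- The coupling x ↦ (x, 0) bounds the distance by the second moment, and Jensen with exponent q/2 ≥
1 passes to the q-th moment. -/
theorem ofReal_W2_diracZero_rpow_le {d : ℕ} (μ : P2 d) {q : ℝ} (hq : 2 ≤ q) :
    ENNReal.ofReal (W2 μ (diracZero d)) ^ q ≤ ∫⁻ y, ‖y‖ₑ ^ q ∂μ.toMeasure := by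
  have := μ.isProbabilityMeasure
  have hm : Measurable fun x : State d => (x, (0 : State d)) := by fun_prop
  have hπ : μ.toMeasure.map (fun x => (x, (0 : State d))) ∈
      couplings μ.toMeasure (diracZero d).toMeasure := by
    constructor
    · rw [Measure.map_map measurable_fst hm]
      exact Measure.map_id
    · rw [Measure.map_map measurable_snd hm]
      change μ.toMeasure.map (fun _ => 0) = _
      simp [Measure.map_const, diracZero]
  have hq0 : 0 ≤ q := by linarith
  calc ENNReal.ofReal (W2 μ (diracZero d)) ^ q
      ≤ ((∫⁻ y, ‖y‖ₑ ^ 2 ∂μ.toMeasure) ^ (1 / 2 : ℝ)) ^ q := by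
        refine ENNReal.rpow_le_rpow (ENNReal.ofReal_toReal_le.trans ?_) hq0
        refine ENNReal.rpow_le_rpow ((iInf₂_le _ hπ).trans_eq ?_) (by norm_num)
        rw [lintegral_map (by fun_prop) hm]
        simp
    _ = (∫⁻ y, ‖y‖ₑ ^ 2 ∂μ.toMeasure) ^ (q / 2) := by
        rw [← ENNReal.rpow_mul]
        congr 1
        ring
    _ ≤ μ.toMeasure univ ^ (q / 2 - 1) * ∫⁻ y, (‖y‖ₑ ^ 2) ^ (q / 2) ∂μ.toMeasure :=
        rpow_lintegral_le (by fun_prop) (by linarith)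
    _ = _ := by
        rw [measure_univ, ENNReal.one_rpow, one_mul]
        refine lintegral_congr fun y => ?_
        rw [← ENNReal.rpow_natCast, ← ENNReal.rpow_mul]
        congr 1
        push_cast
        ring

theorem LipschitzDrift.rpow_enorm_le {d : ℕ} {L q : ℝ} {b : State d → P2 d → State d}
    (hb : LipschitzDrift L b) (hL : 0 ≤ L) (hq : 2 ≤ q) (x : State d) (μ : P2 d) :
    ‖b x μ‖ₑ ^ q ≤ 3 ^ (q - 1) * ENNReal.ofReal L ^ q *
      (1 + ‖x‖ₑ ^ q + ∫⁻ y, ‖y‖ₑ ^ q ∂μ.toMeasure) := by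
  have hq0 : 0 ≤ q := by linarith
  have hW : 0 ≤ W2 μ (diracZero d) := ENNReal.toReal_nonneg
  have h : ‖b x μ‖ ≤ L * (1 + ‖x‖ + W2 μ (diracZero d)) := by
    have h1 := hb.lipschitz x 0 μ (diracZero d)
    have h2 := hb.bound_zero
    have h3 : ‖b x μ‖ ≤ ‖b x μ - b 0 (diracZero d)‖ + ‖b 0 (diracZero d)‖ := by
      simpa using norm_add_le (b x μ - b 0 (diracZero d)) (b 0 (diracZero d))
    rw [sub_zero] at h1
    linarith
  calc ‖b x μ‖ₑ ^ q
      ≤ (ENNReal.ofReal L * (1 + ‖x‖ₑ + ENNReal.ofReal (W2 μ (diracZero d)))) ^ q := by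
        refine ENNReal.rpow_le_rpow ?_ hq0
        rw [← ofReal_norm, ← ofReal_norm, ← ENNReal.ofReal_one,
          ← ENNReal.ofReal_add zero_le_one (norm_nonneg _),
          ← ENNReal.ofReal_add (by positivity) hW, ← ENNReal.ofReal_mul hL]
        exact ENNReal.ofReal_le_ofReal h
    _ ≤ ENNReal.ofReal L ^ q * (3 ^ (q - 1) *
        (1 ^ q + ‖x‖ₑ ^ q + ENNReal.ofReal (W2 μ (diracZero d)) ^ q)) := by
        rw [ENNReal.mul_rpow_of_nonneg _ _ hq0]
        gcongr
        exact rpow_add_add_le _ _ _ (by linarith)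
    _ ≤ ENNReal.ofReal L ^ q * (3 ^ (q - 1) *
        (1 + ‖x‖ₑ ^ q + ∫⁻ y, ‖y‖ₑ ^ q ∂μ.toMeasure)) := by
        rw [ENNReal.one_rpow]
        gcongr
        exact ofReal_W2_diracZero_rpow_le μ hq
    _ = _ := by ring

theorem W2_self {d : ℕ} (μ : P2 d) : W2 μ μ = 0 := by
  have hm : Measurable fun x : State d => (x, x) := by fun_prop
  have hπ : μ.toMeasure.map (fun x => (x, x)) ∈ couplings μ.toMeasure μ.toMeasure := by
    constructor
    · rw [Measure.map_map measurable_fst hm]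
      exact Measure.map_id
    · rw [Measure.map_map measurable_snd hm]
      exact Measure.map_id
  have h : (⨅ π ∈ couplings μ.toMeasure μ.toMeasure,
      ∫⁻ z : State d × State d, ‖z.1 - z.2‖ₑ ^ 2 ∂π) ≤ 0 := by
    refine (iInf₂_le _ hπ).trans_eq ?_
    rw [lintegral_map (by fun_prop) hm]
    simp
  rw [W2, le_zero_iff.1 h]
  simp

theorem LipschitzDrift.rpow_enorm_sub_le {d : ℕ} {L q : ℝ} {b : State d → P2 d → State d}
    (hb : LipschitzDrift L b) (hL : 0 ≤ L) (hq : 0 ≤ q) (x y : State d) (μ : P2 d) :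
    ‖b x μ - b y μ‖ₑ ^ q ≤ ENNReal.ofReal L ^ q * ‖x - y‖ₑ ^ q := by
  rw [← ENNReal.mul_rpow_of_nonneg _ _ hq]
  refine ENNReal.rpow_le_rpow ?_ hq
  rw [← ofReal_norm, ← ofReal_norm, ← ENNReal.ofReal_mul hL]
  refine ENNReal.ofReal_le_ofReal ((hb.lipschitz x y μ μ).trans_eq ?_)
  rw [W2_self, add_zero]

theorem lintegral_rpow_empirical {d N : ℕ} [NeZero N] (x : Fin N → State d) (q : ℝ) :
    ∫⁻ y, ‖y‖ₑ ^ q ∂(empirical x).toMeasure = (N : ℝ≥0∞)⁻¹ * ∑ j, ‖x j‖ₑ ^ q := by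
  simp only [empirical, empiricalMeasure, lintegral_smul_measure, lintegral_finsetSum_measure,
    lintegral_dirac, smul_eq_mul]

/-! ### Moments of the Gaussian noise. -/

/-- A centred Gaussian has the law of its standard deviation times a standard normal, so the
variance alone controls every moment. -/
theorem lintegral_rpow_enorm_of_gaussian {Ω : Type*} [MeasurableSpace Ω] {P : Measure Ω}
    {Z : Ω → ℝ} (hZ : HasGaussianLaw Z P) (h0 : ∫ ω, Z ω ∂P = 0) {q : ℝ} (hq : 0 ≤ q) :
    ∫⁻ ω, ‖Z ω‖ₑ ^ q ∂P = ENNReal.ofReal (√(∫ ω, Z ω * Z ω ∂P)) ^ q *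
      ∫⁻ z, ‖z‖ₑ ^ q ∂(gaussianReal 0 1) := by
  have := hZ.isProbabilityMeasure
  set v : ℝ := ∫ ω, Z ω * Z ω ∂P with hv
  have hv0 : 0 ≤ v := integral_nonneg fun ω => mul_self_nonneg _
  have hvar : Var[Z; P] = v := by
    rw [variance_eq_sub hZ.memLp_two, h0]
    simp [hv, pow_two]
  have hmap : P.map Z = (gaussianReal 0 1).map (fun x => √v * x) := by
    rw [hZ.map_eq_gaussianReal, h0, hvar, gaussianReal_map_const_mul]
    congr 1
    · simp
    · ext
      simp [Real.sq_sqrt hv0, hv0]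
  have h1 : ∫⁻ ω, ‖Z ω‖ₑ ^ q ∂P = ∫⁻ z, ‖z‖ₑ ^ q ∂(P.map Z) :=
    (lintegral_map' (f := fun z => ‖z‖ₑ ^ q) (by fun_prop) hZ.aemeasurable).symm
  rw [h1, hmap, lintegral_map (by fun_prop) (by fun_prop), ← lintegral_const_mul _ (by fun_prop)]
  refine lintegral_congr fun z => ?_
  rw [enorm_mul, ENNReal.mul_rpow_of_nonneg _ _ hq, Real.enorm_of_nonneg (Real.sqrt_nonneg _)]

theorem lintegral_rpow_enorm_gaussianReal_ne_top {q : ℝ} (hq : 0 < q) :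
    ∫⁻ z, ‖z‖ₑ ^ q ∂(gaussianReal 0 1) ≠ ∞ := by
  have h := (memLp_id_gaussianReal (μ := 0) (v := 1) q.toNNReal).eLpNorm_lt_top
  have h2 := lintegral_rpow_enorm_lt_top_of_eLpNorm_lt_top (by simpa using hq) (by simp) h
  simpa [hq.le] using h2.ne

theorem enorm_le_sum_enorm {d : ℕ} (x : State d) : ‖x‖ₑ ≤ ∑ k, ‖x k‖ₑ := by
  conv_lhs => rw [← (EuclideanSpace.basisFun (Fin d) ℝ).sum_repr x]
  refine (enorm_sum_le _ _).trans (Finset.sum_le_sum fun k _ => ?_)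
  rw [enorm_smul]
  simp [← ofReal_norm]

/-- The moments of the noise `ξ (B_t - B_0)` are bounded by a constant that depends on the law of
the fractional Brownian motion only. -/
theorem exists_lintegral_noise_le (d : ℕ) {H T q : ℝ} (ξ : Matrix (Fin d) (Fin d) ℝ)
    (hH : 0 < H) (hT : 0 ≤ T) (hq : 1 ≤ q) :
    ∃ ν : ℝ≥0, ∀ (Ω : Type*) [MeasurableSpace Ω] (P : Measure Ω) (B : ℝ → Ω → State d),
      IsFBM H T P B → ∀ t ∈ Icc 0 T,
        ∫⁻ ω, ‖Matrix.toEuclideanCLM (𝕜 := ℝ) ξ (B t ω - B 0 ω)‖ₑ ^ q ∂P ≤ ν := by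
  have hq0 : 0 < q := by linarith
  have hq1 : 0 ≤ q - 1 := by linarith
  set g : ℝ≥0∞ := ∫⁻ z, ‖z‖ₑ ^ q ∂(gaussianReal 0 1) with hg
  have hg_top : g ≠ ∞ := lintegral_rpow_enorm_gaussianReal_ne_top hq0
  set κ : ℝ≥0∞ := (d : ℝ≥0∞) ^ (q - 1) * (d * (ENNReal.ofReal (√(T ^ (2 * H))) ^ q * g))
    with hκ
  set ν : ℝ≥0∞ := ‖Matrix.toEuclideanCLM (𝕜 := ℝ) ξ‖ₑ ^ q * (2 ^ (q - 1) * (κ + κ)) with hν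
  have hν_top : ν ≠ ∞ := by
    have : κ ≠ ∞ := by finiteness
    finiteness
  refine ⟨ν.toNNReal, fun Ω _ P B hB t ht => ?_⟩
  rw [ENNReal.coe_toNNReal hν_top]
  have hmom : ∀ t ∈ Icc 0 T, ∫⁻ ω, ‖B t ω‖ₑ ^ q ∂P ≤ κ := by
    intro t ht
    have hBm := hB.measurable t ht
    have hcoord : ∀ k, ∫⁻ ω, ‖B t ω k‖ₑ ^ q ∂P ≤
        ENNReal.ofReal (√(T ^ (2 * H))) ^ q * g := by
      intro k
      have hG : HasGaussianLaw (fun ω => B t ω k) P :=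
        (hB.gaussian.hasGaussianLaw_eval ⟨t, ht⟩).map_fun (EuclideanSpace.proj (𝕜 := ℝ) k)
      rw [lintegral_rpow_enorm_of_gaussian hG (hB.centred t ht k) hq0.le,
        hB.covariance t ht t ht k k]
      gcongr
      -- On the diagonal the covariance is t^(2H) because 0^(2H) = 0, which needs H ≠ 0.
      have h2H : (2 * H) ≠ 0 := by positivity
      have := Real.rpow_le_rpow ht.1 ht.2 (by positivity : 0 ≤ 2 * H)
      simp only [if_true, sub_self, abs_zero, Real.zero_rpow h2H]
      linarith
    calc ∫⁻ ω, ‖B t ω‖ₑ ^ q ∂P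
        ≤ ∫⁻ ω, (d : ℝ≥0∞) ^ (q - 1) * ∑ k, ‖B t ω k‖ₑ ^ q ∂P := by
          refine lintegral_mono fun ω => ?_
          refine (ENNReal.rpow_le_rpow (enorm_le_sum_enorm _) hq0.le).trans ?_
          simpa using ENNReal.rpow_sum_le_const_mul_sum_rpow Finset.univ
            (fun k => ‖B t ω k‖ₑ) hq
      _ = (d : ℝ≥0∞) ^ (q - 1) * ∑ k, ∫⁻ ω, ‖B t ω k‖ₑ ^ q ∂P := by
          rw [lintegral_const_mul' _ _ (by finiteness), lintegral_finsetSum]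
          intro k _
          fun_prop
      _ ≤ (d : ℝ≥0∞) ^ (q - 1) * ∑ _k : Fin d, ENNReal.ofReal (√(T ^ (2 * H))) ^ q * g := by
          gcongr with k
          exact hcoord k
      _ = κ := by simp [hκ]
  have h0 : (0 : ℝ) ∈ Icc 0 T := ⟨le_rfl, hT⟩
  have hBm := hB.measurable t ht
  calc ∫⁻ ω, ‖Matrix.toEuclideanCLM (𝕜 := ℝ) ξ (B t ω - B 0 ω)‖ₑ ^ q ∂P
      ≤ ∫⁻ ω, ‖Matrix.toEuclideanCLM (𝕜 := ℝ) ξ‖ₑ ^ q *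
          (2 ^ (q - 1) * (‖B t ω‖ₑ ^ q + ‖B 0 ω‖ₑ ^ q)) ∂P := by
        refine lintegral_mono fun ω => ?_
        calc ‖Matrix.toEuclideanCLM (𝕜 := ℝ) ξ (B t ω - B 0 ω)‖ₑ ^ q
            ≤ (‖Matrix.toEuclideanCLM (𝕜 := ℝ) ξ‖ₑ * (‖B t ω‖ₑ + ‖B 0 ω‖ₑ)) ^ q := by
              refine ENNReal.rpow_le_rpow ?_ hq0.le
              refine (ContinuousLinearMap.le_opENorm _ _).trans ?_
              gcongr
              exact enorm_sub_le
          _ ≤ _ := by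
              rw [ENNReal.mul_rpow_of_nonneg _ _ hq0.le]
              gcongr
              exact ENNReal.rpow_add_le_mul_rpow_add_rpow _ _ hq
    _ = ‖Matrix.toEuclideanCLM (𝕜 := ℝ) ξ‖ₑ ^ q *
          (2 ^ (q - 1) * (∫⁻ ω, ‖B t ω‖ₑ ^ q ∂P + ∫⁻ ω, ‖B 0 ω‖ₑ ^ q ∂P)) := by
        rw [lintegral_const_mul' _ _ (by finiteness), lintegral_const_mul' _ _ (by finiteness),
          lintegral_add_left (by fun_prop)]
    _ ≤ ν := by
        rw [hν]
        gcongr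
        · exact hmom t ht
        · exact hmom 0 h0

/-! ### Moment bounds for the two equations. -/

section

variable {d : ℕ} {Ω : Type*} [MeasurableSpace Ω] {P : Measure Ω} {H T L q : ℝ}
  {b : State d → P2 d → State d} {ξ : Matrix (Fin d) (Fin d) ℝ}

theorem exists_rpow_enorm_le {E : Type*} [NormedAddCommGroup E] {x : ℝ → E}
    (hx : ContinuousOn x (Icc 0 T)) (hq : 0 ≤ q) :
    ∃ M : ℝ≥0∞, M ≠ ∞ ∧ ∀ t ∈ Icc 0 T, ‖x t‖ₑ ^ q ≤ M := by
  obtain ⟨C, hC⟩ := isCompact_Icc.exists_bound_of_continuousOn hx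
  refine ⟨ENNReal.ofReal C ^ q, by finiteness, fun t ht => ?_⟩
  refine ENNReal.rpow_le_rpow ?_ hq
  rw [← ofReal_norm]
  exact ENNReal.ofReal_le_ofReal (hC t ht)

theorem rpow_enorm_sub_le {E : Type*} [NormedAddCommGroup E] (x y : E) (hq : 1 ≤ q) :
    ‖x - y‖ₑ ^ q ≤ 2 ^ (q - 1) * (‖x‖ₑ ^ q + ‖y‖ₑ ^ q) :=
  (ENNReal.rpow_le_rpow enorm_sub_le (by linarith)).trans
    (ENNReal.rpow_add_le_mul_rpow_add_rpow _ _ hq)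

theorem SolvesEquation.rpow_enorm_le {X0 : Ω → State d} {B X : ℝ → Ω → State d}
    {m : ℝ → Ω → P2 d} (hX : SolvesEquation T b ξ P X0 B m X) (hb : LipschitzDrift L b)
    (hL : 0 ≤ L) (hq : 2 ≤ q) :
    ∀ᵐ ω ∂P, ∀ t ∈ Icc 0 T, ‖X t ω‖ₑ ^ q ≤
      pathConst T L q * (1 + ‖X0 ω‖ₑ ^ q +
        ‖Matrix.toEuclideanCLM (𝕜 := ℝ) ξ (B t ω - B 0 ω)‖ₑ ^ q) +
      pathConst T L q * ∫⁻ s in Icc 0 t,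
        (‖X s ω‖ₑ ^ q + ∫⁻ y, ‖y‖ₑ ^ q ∂(m s ω).toMeasure) := by
  filter_upwards [hX.integrable, hX.equation] with ω hi he
  exact rpow_enorm_path_le (by linarith) hi he fun s _ => hb.rpow_enorm_le hL hq _ _

/-- Exchanging expectation and time integral requires a jointly measurable forcing, whereas B is
measurable only at each fixed time and `X0` only almost everywhere. -/
theorem IsFBM.exists_measurable_forcing {X0 : Ω → State d} {B : ℝ → Ω → State d}
    [IsProbabilityMeasure P] (hX0 : AEMeasurable X0 P) (hB : IsFBM H T P B) (hT : 0 ≤ T)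
    {ν : ℝ≥0} (c : ℝ≥0)
    (hν : ∀ t ∈ Icc 0 T,
      ∫⁻ ω, ‖Matrix.toEuclideanCLM (𝕜 := ℝ) ξ (B t ω - B 0 ω)‖ₑ ^ q ∂P ≤ ν) :
    ∃ α : ℝ → Ω → ℝ≥0∞, Measurable (Function.uncurry α) ∧
      (∀ᵐ ω ∂P, ∀ t ∈ Icc 0 T, α t ω = c * (1 + ‖X0 ω‖ₑ ^ q +
        ‖Matrix.toEuclideanCLM (𝕜 := ℝ) ξ (B t ω - B 0 ω)‖ₑ ^ q)) ∧
      ∀ t ∈ Icc 0 T, ∫⁻ ω, α t ω ∂P ≤ c * (1 + ∫⁻ ω, ‖X0 ω‖ₑ ^ q ∂P + ν) := by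
  obtain ⟨W, hWm, hW⟩ := exists_measurable_uncurry hT hB.measurable hB.continuous
  have h0 : (0 : ℝ) ∈ Icc 0 T := ⟨le_rfl, hT⟩
  have hW0 : Measurable (W 0) := hWm.of_uncurry_left
  have hα : ∀ᵐ ω ∂P, ∀ t ∈ Icc 0 T, (c : ℝ≥0∞) * (1 + ‖hX0.mk X0 ω‖ₑ ^ q +
      ‖Matrix.toEuclideanCLM (𝕜 := ℝ) ξ (W t ω - W 0 ω)‖ₑ ^ q) = c * (1 + ‖X0 ω‖ₑ ^ q +
        ‖Matrix.toEuclideanCLM (𝕜 := ℝ) ξ (B t ω - B 0 ω)‖ₑ ^ q) := by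
    filter_upwards [hW, hX0.ae_eq_mk] with ω hWω hω t ht
    rw [hWω t ht, hWω 0 h0, hω]
  refine ⟨fun t ω => c * (1 + ‖hX0.mk X0 ω‖ₑ ^ q +
    ‖Matrix.toEuclideanCLM (𝕜 := ℝ) ξ (W t ω - W 0 ω)‖ₑ ^ q), ?_, hα, fun t ht => ?_⟩
  · have h1 : Measurable fun p : ℝ × Ω => W p.1 p.2 := hWm
    have h2 : Measurable (hX0.mk X0) := hX0.measurable_mk
    change Measurable fun p : ℝ × Ω => (c : ℝ≥0∞) * (1 + ‖hX0.mk X0 p.2‖ₑ ^ q +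
      ‖Matrix.toEuclideanCLM (𝕜 := ℝ) ξ (W p.1 p.2 - W 0 p.2)‖ₑ ^ q)
    fun_prop
  · have hmeas : AEMeasurable (fun ω => 1 + ‖X0 ω‖ₑ ^ q) P := by fun_prop
    calc _ = ∫⁻ ω, c * (1 + ‖X0 ω‖ₑ ^ q +
          ‖Matrix.toEuclideanCLM (𝕜 := ℝ) ξ (B t ω - B 0 ω)‖ₑ ^ q) ∂P :=
          lintegral_congr_ae (hα.mono fun ω hω => hω t ht)
      _ = c * (1 + ∫⁻ ω, ‖X0 ω‖ₑ ^ q ∂P +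
          ∫⁻ ω, ‖Matrix.toEuclideanCLM (𝕜 := ℝ) ξ (B t ω - B 0 ω)‖ₑ ^ q ∂P) := by
          rw [lintegral_const_mul' _ _ (by simp), lintegral_add_left' hmeas,
            lintegral_add_left measurable_const]
          simp
      _ ≤ _ := by
          gcongr
          exact hν t ht

/-- The moment bound for the interacting particle system, with a constant that does not depend on
the number of particles. -/
theorem IsParticleSystem.lintegral_rpow_le [IsProbabilityMeasure P] {N : ℕ} [NeZero N]
    {X0 : Fin N → Ω → State d} {B X : Fin N → ℝ → Ω → State d} {ν : ℝ≥0} {I : ℝ≥0∞}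
    (hX : IsParticleSystem T b ξ P X0 B X) (hb : LipschitzDrift L b)
    (hT : 0 ≤ T) (hL : 0 ≤ L) (hq : 2 ≤ q)
    (hX0 : ∀ i, AEMeasurable (X0 i) P) (hB : ∀ i, IsFBM H T P (B i))
    (hν : ∀ i, ∀ t ∈ Icc 0 T,
      ∫⁻ ω, ‖Matrix.toEuclideanCLM (𝕜 := ℝ) ξ (B i t ω - B i 0 ω)‖ₑ ^ q ∂P ≤ ν)
    (hI : I ≠ ∞) (hX0I : ∀ i, ∫⁻ ω, ‖X0 i ω‖ₑ ^ q ∂P = I) :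
    ∀ i, ∀ t ∈ Icc 0 T, ∫⁻ ω, ‖X i t ω‖ₑ ^ q ∂P ≤
      2 * (pathConst T L q * (1 + I + ν)) *
        ENNReal.ofReal (Real.exp (4 * pathConst T L q * T)) := by
  set c := pathConst T L q with hc
  have hq0 : 0 ≤ q := by linarith
  choose Y hYm hY using fun i => exists_measurable_uncurry hT (hX i).measurable (hX i).continuous
  choose α hαm hαe hαa using fun i => (hB i).exists_measurable_forcing (hX0 i) hT c (hν i)
  simp only [hX0I] at hαa
  have hYall : ∀ᵐ ω ∂P, ∀ i, ∀ t ∈ Icc 0 T, Y i t ω = X i t ω := ae_all_iff.2 hY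
  have hym : ∀ i, Measurable (Function.uncurry fun t ω => ‖Y i t ω‖ₑ ^ q) := fun i =>
    (hYm i).enorm.pow_const q
  have hσm : Measurable (Function.uncurry fun t ω => (N : ℝ≥0∞)⁻¹ * ∑ j, ‖Y j t ω‖ₑ ^ q) :=
    (Finset.measurable_fun_sum _ fun j _ => hym j).const_mul _
  have hineq : ∀ i, ∀ᵐ ω ∂P, ∀ t ∈ Icc 0 T, ‖Y i t ω‖ₑ ^ q ≤ α i t ω +
      c * ∫⁻ s in Icc 0 t, (‖Y i s ω‖ₑ ^ q + (N : ℝ≥0∞)⁻¹ * ∑ j, ‖Y j s ω‖ₑ ^ q) := by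
    intro i
    filter_upwards [(hX i).rpow_enorm_le hb hL hq, hYall, hαe i] with ω h1 h2 h3 t ht
    rw [h2 i t ht, h3 t ht]
    refine (h1 t ht).trans_eq ?_
    congr 2
    refine setLIntegral_congr_fun measurableSet_Icc fun s hs => ?_
    have hs' : s ∈ Icc 0 T := ⟨hs.1, hs.2.trans ht.2⟩
    simp only [lintegral_rpow_empirical, h2 _ s hs']
  have hN1 : (N : ℝ≥0∞)⁻¹ ≤ 1 := by
    rw [ENNReal.inv_le_one]
    exact_mod_cast NeZero.one_le
  -- A priori finiteness only: the empirical average is bounded crudely by the sum, and the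
  -- resulting N-dependent bound does not reach the final constant.
  have hbdd : ∃ M : ℝ≥0∞, M ≠ ∞ ∧ ∀ t ∈ Icc 0 T, ∫⁻ ω, ∑ j, ‖Y j t ω‖ₑ ^ q ∂P ≤ M := by
    refine exists_lintegral_le_of_pathwise_gronwall (α := fun t ω => ∑ j, α j t ω)
      (a := N * ((c : ℝ≥0∞) * (1 + I + ν))) (K := N * c * 2)
      (Finset.measurable_fun_sum _ fun j _ => hαm j) (by finiteness) ?_ ?_ ?_
    · intro t ht
      rw [lintegral_finsetSum _ fun j _ => (hαm j).of_uncurry_left]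
      refine (Finset.sum_le_sum fun j _ => hαa j t ht).trans_eq ?_
      simp
    · filter_upwards [ae_all_iff.2 fun i => (hX i).continuous, hYall] with ω h1 h2
      choose M hM hMb using fun i => exists_rpow_enorm_le (h1 i) hq0
      refine ⟨∑ i, M i, by simpa using hM, fun t ht => Finset.sum_le_sum fun i _ => ?_⟩
      rw [h2 i t ht]
      exact hMb i t ht
    · filter_upwards [ae_all_iff.2 hineq] with ω hω t ht
      calc ∑ j, ‖Y j t ω‖ₑ ^ q
          ≤ ∑ j, (α j t ω + c * ∫⁻ s in Icc 0 t, 2 * ∑ j, ‖Y j s ω‖ₑ ^ q) := by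
            refine Finset.sum_le_sum fun j _ => (hω j t ht).trans ?_
            gcongr with s
            rw [two_mul]
            refine add_le_add ?_ (mul_le_of_le_one_left' hN1)
            exact Finset.single_le_sum (f := fun j => ‖Y j s ω‖ₑ ^ q)
              (fun _ _ => zero_le) (Finset.mem_univ j)
        _ = _ := by
            rw [Finset.sum_add_distrib, lintegral_const_mul' _ _ (by simp)]
            simp
            ring
  obtain ⟨M, hM, hMb⟩ := hbdd
  have key := lintegral_le_of_mean_field_gronwall (P := P) (T := T)
    (y := fun i t ω => ‖Y i t ω‖ₑ ^ q)
    (σ := fun t ω => (N : ℝ≥0∞)⁻¹ * ∑ j, ‖Y j t ω‖ₑ ^ q) hym hσm hαm ?_ hαa hM ?_ hineq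
  · intro i t ht
    refine (lintegral_congr_ae ?_).trans_le (key i t ht)
    filter_upwards [hY i] with ω hω
    rw [hω t ht]
  · intro t ht
    rw [lintegral_const_mul _ (Finset.measurable_fun_sum _ fun j _ => (hym j).of_uncurry_left),
      lintegral_finsetSum _ fun j _ => (hym j).of_uncurry_left]
    calc (N : ℝ≥0∞)⁻¹ * ∑ j, ∫⁻ ω, ‖Y j t ω‖ₑ ^ q ∂P
        ≤ (N : ℝ≥0∞)⁻¹ * ∑ _j : Fin N, ⨆ j, ∫⁻ ω, ‖Y j t ω‖ₑ ^ q ∂P := by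
          gcongr with j
          exact le_iSup (fun j => ∫⁻ ω, ‖Y j t ω‖ₑ ^ q ∂P) j
      _ = _ := by
          rw [Finset.sum_const, Finset.card_univ, Fintype.card_fin, nsmul_eq_mul, ← mul_assoc,
            ENNReal.inv_mul_cancel (by simp [NeZero.ne N]) (by simp), one_mul]
  · intro i t ht
    refine (lintegral_mono fun ω => ?_).trans (hMb t ht)
    exact Finset.single_le_sum (f := fun j => ‖Y j t ω‖ₑ ^ q)
      (fun _ _ => zero_le) (Finset.mem_univ i)

/-- The moments of a solution with deterministic measure flow are bounded in time: the measure
flow cancels in the difference of two paths. -/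
theorem SolvesEquation.exists_lintegral_rpow_le [IsProbabilityMeasure P]
    {X0 : Ω → State d} {B X : ℝ → Ω → State d} {m : ℝ → P2 d} {ν : ℝ≥0}
    (hX : SolvesEquation T b ξ P X0 B (fun t _ => m t) X) (hb : LipschitzDrift L b)
    (hT : 0 ≤ T) (hL : 0 ≤ L) (hq : 1 ≤ q) (hX0 : AEMeasurable X0 P) (hB : IsFBM H T P B)
    (hν : ∀ t ∈ Icc 0 T,
      ∫⁻ ω, ‖Matrix.toEuclideanCLM (𝕜 := ℝ) ξ (B t ω - B 0 ω)‖ₑ ^ q ∂P ≤ ν)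
    (hI : ∫⁻ ω, ‖X0 ω‖ₑ ^ q ∂P ≠ ∞) :
    ∃ M : ℝ≥0∞, M ≠ ∞ ∧ ∀ t ∈ Icc 0 T, ∫⁻ ω, ‖X t ω‖ₑ ^ q ∂P ≤ M := by
  set c := pathConst T L q with hc
  have hq0 : 0 ≤ q := by linarith
  have hq1 : 0 ≤ q - 1 := by linarith
  have h2q : (1 : ℝ≥0∞) ≤ 2 ^ (q - 1) := by
    simpa using ENNReal.rpow_le_rpow_of_exponent_le (x := 2) (by norm_num) hq1
  have h3q : (1 : ℝ≥0∞) ≤ 3 ^ (q - 1) := by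
    simpa using ENNReal.rpow_le_rpow_of_exponent_le (x := 3) (by norm_num) hq1
  obtain ⟨α, hαm, hαe, hαa⟩ := hB.exists_measurable_forcing hX0 hT c hν
  -- One good sample point supplies a deterministic, bounded reference path. Subtracting its
  -- equation avoids any control of the q-th moments of m.
  obtain ⟨ω₀, hi₀, he₀, hc₀, hBc₀⟩ :=
    (hX.integrable.and (hX.equation.and (hX.continuous.and hB.continuous))).exists
  obtain ⟨R, hR, hRb⟩ := exists_rpow_enorm_le hc₀ hq0
  obtain ⟨R', hR', hRb'⟩ := exists_rpow_enorm_le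
    (x := fun t => Matrix.toEuclideanCLM (𝕜 := ℝ) ξ (B t ω₀ - B 0 ω₀))
    (by fun_prop : ContinuousOn _ (Icc 0 T)) hq0
  set ρ := ‖X0 ω₀‖ₑ ^ q with hρ
  have hρ_top : ρ ≠ ∞ := by finiteness
  have hc_top : (c : ℝ≥0∞) ≠ ∞ := by simp
  set A : ℝ → Ω → ℝ≥0∞ := fun t ω => 2 ^ (q - 1) * (α t ω + c * (ρ + R')) with hA
  have hdiff : ∃ M : ℝ≥0∞, M ≠ ∞ ∧
      ∀ t ∈ Icc 0 T, ∫⁻ ω, ‖X t ω - X t ω₀‖ₑ ^ q ∂P ≤ M := by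
    refine exists_lintegral_le_of_pathwise_gronwall (α := A)
      (a := 2 ^ (q - 1) * (c * (1 + ∫⁻ ω, ‖X0 ω‖ₑ ^ q ∂P + ν) + c * (ρ + R'))) (K := c)
      ((hαm.add_const _).const_mul _) (by finiteness) ?_ ?_ ?_
    · intro t ht
      rw [lintegral_const_mul' _ _ (by finiteness), lintegral_add_right _ measurable_const]
      gcongr
      · exact hαa t ht
      · simp
    · filter_upwards [hX.continuous] with ω hω
      exact exists_rpow_enorm_le (hω.sub hc₀) hq0
    · filter_upwards [hX.integrable, hX.equation, hαe] with ω hi he hα t ht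
      -- Both drifts carry the same measure, so the difference is Lipschitz in the state alone and σ
      -- = 0.
      refine (rpow_enorm_path_le (L := L) hq (σ := 0) (x := fun t => X t ω - X t ω₀)
        (n := fun t => Matrix.toEuclideanCLM (𝕜 := ℝ) ξ (B t ω - B 0 ω) -
          Matrix.toEuclideanCLM (𝕜 := ℝ) ξ (B t ω₀ - B 0 ω₀))
        (x₀ := X0 ω - X0 ω₀) (hi.sub hi₀) ?_ ?_ t ht).trans ?_
      · intro u hu
        have hsub : Icc 0 u ⊆ Icc 0 T := Icc_subset_Icc_right hu.2
        have h1 : IntervalIntegrable (fun s => b (X s ω) (m s)) volume 0 u :=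
          (intervalIntegrable_iff_integrableOn_Icc_of_le hu.1).2 (hi.mono_set hsub)
        have h2 : IntervalIntegrable (fun s => b (X s ω₀) (m s)) volume 0 u :=
          (intervalIntegrable_iff_integrableOn_Icc_of_le hu.1).2 (hi₀.mono_set hsub)
        have h3 := intervalIntegral.integral_sub h1 h2
        simp only [Pi.sub_apply]
        rw [h3, he u hu, he₀ u hu]
        abel
      · intro s _
        refine (hb.rpow_enorm_sub_le hL hq0 _ _ _).trans ?_
        rw [mul_assoc]
        refine (le_mul_of_one_le_left' h3q).trans ?_
        gcongr
        exact le_add_self.trans le_self_add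
      · simp only [Pi.zero_apply, add_zero]
        gcongr
        rw [hA]
        simp only [hα t ht]
        calc (c : ℝ≥0∞) * (1 + ‖X0 ω - X0 ω₀‖ₑ ^ q +
              ‖Matrix.toEuclideanCLM (𝕜 := ℝ) ξ (B t ω - B 0 ω) -
                Matrix.toEuclideanCLM (𝕜 := ℝ) ξ (B t ω₀ - B 0 ω₀)‖ₑ ^ q)
            ≤ c * (2 ^ (q - 1) * 1 + 2 ^ (q - 1) * (‖X0 ω‖ₑ ^ q + ρ) + 2 ^ (q - 1) *
              (‖Matrix.toEuclideanCLM (𝕜 := ℝ) ξ (B t ω - B 0 ω)‖ₑ ^ q + R')) := by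
              gcongr
              · simpa using h2q
              · exact rpow_enorm_sub_le _ _ hq
              · refine (rpow_enorm_sub_le _ _ hq).trans ?_
                gcongr
                exact hRb' t ht
          _ = _ := by ring
  obtain ⟨M, hM, hMb⟩ := hdiff
  refine ⟨2 ^ (q - 1) * (M + R), by finiteness, fun t ht => ?_⟩
  calc ∫⁻ ω, ‖X t ω‖ₑ ^ q ∂P
      ≤ ∫⁻ ω, 2 ^ (q - 1) * (‖X t ω - X t ω₀‖ₑ ^ q + R) ∂P := by
        refine lintegral_mono fun ω => ?_
        have := ENNReal.rpow_le_rpow (enorm_add_le (X t ω - X t ω₀) (X t ω₀)) hq0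
        rw [sub_add_cancel] at this
        refine this.trans ((ENNReal.rpow_add_le_mul_rpow_add_rpow _ _ hq).trans ?_)
        gcongr
        exact hRb t ht
    _ = 2 ^ (q - 1) * (∫⁻ ω, ‖X t ω - X t ω₀‖ₑ ^ q ∂P + R) := by
        rw [lintegral_const_mul' _ _ (by finiteness), lintegral_add_right _ measurable_const]
        simp
    _ ≤ _ := by
        gcongr
        exact hMb t ht

/-- The moment bound for the McKean-Vlasov equation. -/
theorem IsMcKeanVlasovSolution.lintegral_rpow_le [IsProbabilityMeasure P]
    {X0 : Ω → State d} {B X : ℝ → Ω → State d} {ν : ℝ≥0}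
    (hX : IsMcKeanVlasovSolution T b ξ P X0 B X) (hb : LipschitzDrift L b)
    (hT : 0 ≤ T) (hL : 0 ≤ L) (hq : 2 ≤ q) (hX0 : AEMeasurable X0 P) (hB : IsFBM H T P B)
    (hν : ∀ t ∈ Icc 0 T,
      ∫⁻ ω, ‖Matrix.toEuclideanCLM (𝕜 := ℝ) ξ (B t ω - B 0 ω)‖ₑ ^ q ∂P ≤ ν)
    (hI : ∫⁻ ω, ‖X0 ω‖ₑ ^ q ∂P ≠ ∞) :
    ∀ t ∈ Icc 0 T, ∫⁻ ω, ‖X t ω‖ₑ ^ q ∂P ≤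
      2 * (pathConst T L q * (1 + ∫⁻ ω, ‖X0 ω‖ₑ ^ q ∂P + ν)) *
        ENNReal.ofReal (Real.exp (4 * pathConst T L q * T)) := by
  obtain ⟨m, hm, hXm⟩ := hX
  obtain ⟨Y, hYm, hY⟩ := exists_measurable_uncurry hT hXm.measurable hXm.continuous
  obtain ⟨α, hαm, hαe, hαa⟩ :=
    hB.exists_measurable_forcing hX0 hT (pathConst T L q) hν
  obtain ⟨M, hM, hMb⟩ :=
    hXm.exists_lintegral_rpow_le hb hT hL (by linarith) hX0 hB hν hI
  have hYX : ∀ t ∈ Icc 0 T, ∫⁻ ω, ‖Y t ω‖ₑ ^ q ∂P = ∫⁻ ω, ‖X t ω‖ₑ ^ q ∂P := by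
    intro t ht
    refine lintegral_congr_ae ?_
    filter_upwards [hY] with ω hω
    rw [hω t ht]
  have hym : Measurable (Function.uncurry fun t ω => ‖Y t ω‖ₑ ^ q) := hYm.enorm.pow_const q
  have hh : Measurable fun t => ∫⁻ ω, ‖Y t ω‖ₑ ^ q ∂P := hym.lintegral_prod_right'
  -- McKean-Vlasov is treated as a single particle whose interaction term is its own deterministic
  -- q-th moment.
  have key := lintegral_le_of_mean_field_gronwall (ι := Unit) (P := P) (T := T)
    (y := fun _ t ω => ‖Y t ω‖ₑ ^ q) (α := fun _ => α)
    (σ := fun t _ => ∫⁻ ω, ‖Y t ω‖ₑ ^ q ∂P) (fun _ => hym) (hh.comp measurable_fst)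
    (fun _ => hαm) (by simp) (fun _ => hαa) hM ?_ ?_ (K := pathConst T L q)
  · intro t ht
    rw [← hYX t ht]
    exact key () t ht
  · intro _ t ht
    rw [hYX t ht]
    exact hMb t ht
  · intro _
    filter_upwards [hXm.rpow_enorm_le hb hL hq, hY, hαe] with ω h1 h2 h3 t ht
    rw [h2 t ht, h3 t ht]
    refine (h1 t ht).trans_eq ?_
    congr 2
    refine setLIntegral_congr_fun measurableSet_Icc fun s hs => ?_
    have hs' : s ∈ Icc 0 T := ⟨hs.1, hs.2.trans ht.2⟩
    simp only [h2 s hs', hYX s hs']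
    rw [hm s hs', lintegral_map (by fun_prop) (hXm.measurable s hs')]

end

end FBMParticles

/-! ### Assembling the uniform constant. -/

theorem theorem3p9 (d : ℕ) (H T L q : ℝ) (ξ : Matrix (Fin d) (Fin d) ℝ)
    (hH : H ∈ Ioo (0 : ℝ) (1 / 2)) (hT : 0 < T) (hL : 0 < L) (hq : 2 < q) :
    ∃ C : ℝ≥0, 0 < C ∧
      ∀ (b : FBMParticles.State d → FBMParticles.P2 d → FBMParticles.State d),
        FBMParticles.LipschitzDrift L b →
      ∀ (Ω : Type*) [MeasurableSpace Ω] (P : Measure Ω) [IsProbabilityMeasure P]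
        (N : ℕ) [NeZero N]
        (X0 : Fin N → Ω → FBMParticles.State d)
        (B X XN : Fin N → ℝ → Ω → FBMParticles.State d),
        (∀ i j, IdentDistrib (X0 i) (X0 j) P P) →
        (∀ i, FBMParticles.IsFBM H T P (B i)) →
        (∀ i, FBMParticles.IsMcKeanVlasovSolution T b ξ P (X0 i) (B i) (X i)) →
        FBMParticles.IsParticleSystem T b ξ P X0 B XN →
        ∀ i, (⨆ t ∈ Icc 0 T, ∫⁻ ω, ‖X i t ω‖ₑ ^ q ∂P)
            + (⨆ t ∈ Icc 0 T, ∫⁻ ω, ‖XN i t ω‖ₑ ^ q ∂P)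
          ≤ C * (1 + ∫⁻ ω, ‖X0 i ω‖ₑ ^ q ∂P) := by

  obtain ⟨ν, hν⟩ := FBMParticles.exists_lintegral_noise_le d (q := q) ξ hH.1 hT.le (by linarith)
  set c := FBMParticles.pathConst T L q with hc
  set e : ℝ≥0 := (Real.exp (4 * c * T)).toNNReal with he
  -- The factor 4 adds the two bounds with factor 2, and 1 + I + ν ≤ (1 + ν)(1 + I) for the initial
  -- moment I. The final +1 makes the constant positive, which also settles the case I = ∞.
  refine ⟨4 * (c * (1 + ν)) * e + 1, by positivity, ?_⟩
  intro b hb Ω _ P _ N _ X0 B X XN hX0 hB hX hXN i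
  by_cases hI : ∫⁻ ω, ‖X0 i ω‖ₑ ^ q ∂P = ∞
  · rw [hI, add_top, ENNReal.mul_top (by positivity)]
    exact le_top
  have hm : ∀ i, AEMeasurable (X0 i) P := fun i => (hX0 i i).aemeasurable_fst
  have hX0I : ∀ j, ∫⁻ ω, ‖X0 j ω‖ₑ ^ q ∂P = ∫⁻ ω, ‖X0 i ω‖ₑ ^ q ∂P := fun j =>
    ((hX0 j i).comp (u := fun x => ‖x‖ₑ ^ q) (by fun_prop)).lintegral_eq
  have h1 := (hX i).lintegral_rpow_le hb hT.le hL.le hq.le (hm i) (hB i) (hν Ω P _ (hB i)) hI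
  have h2 := hXN.lintegral_rpow_le hb hT.le hL.le hq.le hm hB (fun j => hν Ω P _ (hB j)) hI
    hX0I i
  set I := ∫⁻ ω, ‖X0 i ω‖ₑ ^ q ∂P with hIdef
  calc (⨆ t ∈ Icc 0 T, ∫⁻ ω, ‖X i t ω‖ₑ ^ q ∂P) + (⨆ t ∈ Icc 0 T, ∫⁻ ω, ‖XN i t ω‖ₑ ^ q ∂P)
      ≤ 2 * (c * (1 + I + ν)) * e + 2 * (c * (1 + I + ν)) * e :=
        add_le_add (iSup₂_le h1) (iSup₂_le h2)
    _ ≤ 2 * (c * (1 + I + ν)) * e + 2 * (c * (1 + I + ν)) * e +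
        (4 * (c * (ν * I)) * e + (1 + I)) := le_self_add
    _ = _ := by
        push_cast
        ring
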